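/- Let $\omega = -\tfrac12 + \tfrac{\sqrt3}{2}i$ and let $\mathbb{Z}[\omega]=\{a+b\omega : a,b\in\mathbb{Z}\}$ be the ring of Eisenstein integers; for $\alpha,\beta,\mu\in\mathbb{Z}[\omega]$ write $\alpha\equiv\beta\pmod{\mu}$ if $\mu$ divides $\alpha-\beta$ in $\mathbb{Z}[\omega]$. Let $\pi=a+b\omega$ $(a,b\in\mathbb{Z})$ be a primary prime of $\mathbb{Z}[\omega]$, that is, a prime element with $\pi\equiv 2\pmod 3$, and suppose that $\pi\neq 2$. Then the congruence $x^3\equiv 2\pmod{\pi}$ has a solution $x\in\mathbb{Z}[\omega]$ if and only if $\pi\equiv 1\pmod 2$; and $\pi\equiv 1\pmod 2$ holds if and only if $a\equiv 1\pmod 2$ and $b\equiv 0\pmod 2$. -/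

import Mathlib

/-- The ring `ℤ[ω]` of Eisenstein integers: the elements are the `a + b ω` with `a b : ℤ`,
multiplied according to `ω ^ 2 = -1 - ω`. -/
abbrev EisensteinInt : Type := QuadraticAlgebra ℤ (-1) (-1)

namespace EisensteinInt

/-- The element `ω` of `ℤ[ω]`. -/
def omega : EisensteinInt := ⟨0, 1⟩

/-- The complex number `-1/2 + i √3 / 2`, a primitive cube root of unity. -/
noncomputable def omegaC : ℂ := -1 / 2 + Complex.I * (Real.sqrt 3 : ℂ) / 2

theorem omegaC_mul_self : omegaC * omegaC = -1 - omegaC := by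
  have h3 : ((Real.sqrt 3 : ℝ) : ℂ) * ((Real.sqrt 3 : ℝ) : ℂ) = 3 := by
    rw [← Complex.ofReal_mul, Real.mul_self_sqrt (by norm_num)]
    norm_num
  unfold omegaC
  linear_combination (1 / 4) * ((Real.sqrt 3 : ℝ) : ℂ) ^ 2 * Complex.I_mul_I - (1 / 4) * h3

/-- The ring homomorphism `a + b ω ↦ a + b (-1/2 + i √3 / 2)` from `ℤ[ω]` to `ℂ`. -/
noncomputable def toComplex : EisensteinInt →+* ℂ where
  toFun z := (z.re : ℂ) + (z.im : ℂ) * omegaC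
  map_zero' := by simp
  map_one' := by simp [QuadraticAlgebra.re_one, QuadraticAlgebra.im_one]
  map_add' x y := by
    simp only [QuadraticAlgebra.re_add, QuadraticAlgebra.im_add]
    push_cast
    ring
  map_mul' x y := by
    simp only [QuadraticAlgebra.re_mul, QuadraticAlgebra.im_mul]
    push_cast
    linear_combination (-(x.im : ℂ) * (y.im : ℂ)) * omegaC_mul_self

/-- `EisensteinInt` is a copy of the subring `ℤ[ω]` of `ℂ`: the map to `ℂ` is injective. -/
theorem toComplex_injective : Function.Injective toComplex := by
  rw [injective_iff_map_eq_zero]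
  intro z hz
  have hz' : (z.re : ℂ) + (z.im : ℂ) * omegaC = 0 := hz
  have him := congrArg Complex.im hz'
  have hre := congrArg Complex.re hz'
  simp [omegaC] at him hre
  have h : z.im = 0 := him
  rw [h] at hre
  ext
  · simpa using hre
  · exact h

/-- Congruence `α ≡ β (mod μ)` in `ℤ[ω]`: the modulus `μ` divides `α - β`. -/
def Cong (α β μ : EisensteinInt) : Prop := μ ∣ α - β

/-- A primary prime of `ℤ[ω]`: a prime element `π` with `π ≡ 2 (mod 3)`. -/
def IsPrimaryPrime (π : EisensteinInt) : Prop := Prime π ∧ Cong π 2 3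

end EisensteinInt

open Finset

/-! ### Character sums and power sums over a finite field -/

section FiniteField

variable {F : Type*} [Field F] [Fintype F]

/-! Let `F = ℤ[ω]/π`, with `q` elements, and let `χ` be the cubic character lifting `t ↦ t ^ ((q -
1) / 3)` to `ℤ[ω]`. The proof evaluates `J(χ, χ)` in two ways. Exactly, it is `π`
(`jacobiSum_eq_of_isPrimaryPrime`): `π` divides it, the norms agree, and congruences modulo `3`
force the unit quotient to be `1`. Modulo `2`, it is `χ(1/2)² = χ(2)`
(`two_dvd_jacobiSum_self_sub`). Hence `π ≡ χ(2) (mod 2)`; cube roots of unity stay distinct modulo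
`2`, so `π ≡ 1` exactly when `χ(2) = 1`, that is, when `2` is a cube in `F`. -/

/-- Modulo `2`, only the fixed point `1 / 2` of `t ↦ 1 - t` contributes to `J(χ, χ)`. -/
theorem MulChar.two_dvd_jacobiSum_self_sub {R : Type*} [CommRing R] (χ : MulChar F R)
    (h2 : (2 : F) ≠ 0) : (2 : R) ∣ jacobiSum χ χ - χ 2⁻¹ * χ 2⁻¹ := by
  classical
  have half : (1 : F) - 2⁻¹ = 2⁻¹ := by field_simp; norm_num
  have hfix : ∀ t : F, 1 - t = t → t = 2⁻¹ := by
    intro t ht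
    exact eq_inv_of_mul_eq_one_left (by linear_combination -ht)
  have key : jacobiSum χ χ - χ 2⁻¹ * χ 2⁻¹ = ∑ t ∈ univ.erase (2⁻¹ : F), χ t * χ (1 - t) := by
    rw [jacobiSum, ← add_sum_erase univ _ (mem_univ (2⁻¹ : F)), half]
    ring
  rw [key, ← Ideal.mem_span_singleton, ← Ideal.Quotient.eq_zero_iff_mem, map_sum]
  refine sum_involution (fun t _ ↦ 1 - t) ?_ ?_ ?_ ?_
  · intro t _
    rw [← map_add, Ideal.Quotient.eq_zero_iff_mem, Ideal.mem_span_singleton]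
    exact ⟨χ t * χ (1 - t), by rw [sub_sub_cancel]; ring⟩
  · intro t ht _ h
    exact (mem_erase.mp ht).1 (hfix t h)
  · intro t ht
    refine mem_erase.mpr ⟨fun h ↦ (mem_erase.mp ht).1 ?_, mem_univ _⟩
    rw [← half, ← h]
    ring
  · intro t _
    exact sub_sub_cancel 1 t

theorem FiniteField.sum_pow_mul_one_sub_pow_eq_zero {m n : ℕ} (h : m + n < Fintype.card F - 1) :
    ∑ t : F, t ^ m * (1 - t) ^ n = 0 := by
  have expand : ∀ t : F, t ^ m * (1 - t) ^ n =
      ∑ k ∈ range (n + 1), ((-1) ^ k * (n.choose k : F)) * t ^ (m + k) := by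
    intro t
    rw [sub_eq_neg_add, add_pow, mul_sum]
    refine sum_congr rfl fun k _ ↦ ?_
    rw [neg_pow, one_pow, pow_add]
    ring
  simp_rw [expand]
  rw [sum_comm]
  refine sum_eq_zero fun k hk ↦ ?_
  rw [← mul_sum, FiniteField.sum_pow_lt_card_sub_one, mul_zero]
  have := mem_range.mp hk
  omega

theorem FiniteField.exists_pow_eq_of_pow_eq_one {m n : ℕ} (hm : 0 < m)
    (hq : Fintype.card F - 1 = n * m) {a : F} (ha : a ≠ 0) (h : a ^ m = 1) :
    ∃ b : F, b ^ n = a := by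
  classical
  obtain ⟨g, hg⟩ := IsCyclic.exists_generator (α := Fˣ)
  obtain ⟨k, hk⟩ := mem_powers_iff_mem_zpowers.mpr (hg (Units.mk0 a ha))
  have hk : g ^ k = Units.mk0 a ha := hk
  have hk1 : g ^ (k * m) = 1 := by
    rw [pow_mul, hk]
    ext
    simpa using h
  have hord : orderOf g = n * m := by
    rw [orderOf_eq_card_of_forall_mem_zpowers hg, Nat.card_eq_fintype_card, Fintype.card_units, hq]
  obtain ⟨j, rfl⟩ : n ∣ k := by
    rw [← Nat.mul_dvd_mul_iff_right hm, ← hord]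
    exact orderOf_dvd_of_pow_eq_one hk1
  refine ⟨((g ^ j : Fˣ) : F), ?_⟩
  rw [← Units.val_pow_eq_pow_val, ← pow_mul, mul_comm, hk, Units.val_mk0]

end FiniteField

namespace EisensteinInt

/-! ### Arithmetic of the Eisenstein integers -/

open QuadraticAlgebra ComplexConjugate

instance : IsDomain EisensteinInt := toComplex_injective.isDomain

theorem omega_sq : omega ^ 2 + omega + 1 = 0 := by
  rw [sq]
  ext <;> simp [omega, re_one, im_one]

theorem omega_pow_three : omega ^ 3 = 1 := by
  linear_combination (omega - 1) * omega_sq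

theorem isPrimitiveRoot_omega : IsPrimitiveRoot omega 3 := by
  rw [IsPrimitiveRoot.iff_orderOf]
  refine orderOf_eq_prime omega_pow_three fun h ↦ ?_
  have := congrArg QuadraticAlgebra.im h
  simp [omega, im_one] at this

theorem norm_eq (z : EisensteinInt) : z.norm = z.re ^ 2 - z.re * z.im + z.im ^ 2 := by
  rw [norm_def]
  ring

theorem norm_nonneg (z : EisensteinInt) : 0 ≤ z.norm := by
  rw [norm_eq]
  nlinarith [sq_nonneg (2 * z.re - z.im), sq_nonneg z.im]

theorem normSq_toComplex (z : EisensteinInt) : Complex.normSq (toComplex z) = z.norm := by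
  have hz : toComplex z = (z.re : ℂ) + (z.im : ℂ) * omegaC := rfl
  have h3 : Real.sqrt 3 * Real.sqrt 3 = 3 := Real.mul_self_sqrt (by norm_num)
  rw [hz, Complex.normSq_apply, norm_eq]
  simp [omegaC]
  linear_combination (z.im : ℝ) ^ 2 / 4 * h3

theorem eq_one_of_norm_eq_one {u : EisensteinInt} (hn : u.norm = 1)
    (h3 : (3 : EisensteinInt) ∣ u - 1) : u = 1 := by
  obtain ⟨s, hs⟩ := h3
  have hre : u.re - 1 = 3 * s.re := by simpa [re_one] using congrArg QuadraticAlgebra.re hs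
  have him : u.im = 3 * s.im := by simpa [im_one] using congrArg QuadraticAlgebra.im hs
  rw [norm_eq] at hn
  have him0 : s.im = 0 := by
    -- Four times the norm form; the coefficient `27` exceeds `4`, so `s.im` vanishes.
    have hsq : (2 * u.re - u.im) ^ 2 + 27 * s.im ^ 2 = 4 := by
      rw [him] at hn ⊢
      linear_combination 4 * hn
    have h0 := sq_nonneg (2 * u.re - u.im)
    have h1 := sq_nonneg s.im
    exact (pow_eq_zero_iff two_ne_zero).mp (by omega : s.im ^ 2 = 0)
  rw [him0, mul_zero] at him
  rw [him] at hn
  have hre1 : u.re = 1 := by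
    have : (u.re - 1) * (u.re + 1) = 0 := by linear_combination hn
    rcases mul_eq_zero.mp this with h | h <;> omega
  ext
  · simpa [re_one] using hre1
  · simpa [im_one] using him

theorem isUnit_of_norm_eq_one {u : EisensteinInt} (hn : u.norm = 1) : IsUnit u := by
  rw [isUnit_iff_norm_isUnit, hn]
  exact isUnit_one

/-- Otherwise `u² + u + 1 = 0`, and reducing modulo `2` with `u ≡ 1` makes `2` divide `1`. -/
theorem eq_one_of_pow_three_eq_one {u : EisensteinInt} (h : u ^ 3 = 1)
    (h2 : (2 : EisensteinInt) ∣ u - 1) : u = 1 := by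
  obtain ⟨y, hy⟩ := h2
  have hmul : (u - 1) * (u ^ 2 + u + 1) = 0 := by linear_combination h
  rcases mul_eq_zero.mp hmul with h | h
  · exact sub_eq_zero.mp h
  · have hu : u = 1 + 2 * y := by linear_combination hy
    have h1 : (1 : EisensteinInt) = 2 * (-1 - 3 * y - 2 * y ^ 2) := by
      rw [hu] at h
      linear_combination h
    have hre := congrArg QuadraticAlgebra.re h1
    simp only [re_one, re_mul, re_ofNat, im_ofNat, zero_mul, mul_zero, add_zero] at hre
    omega

/-- The index of the ideal is the absolute determinant of multiplication by `π`, which is the norm.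
-/
theorem card_quotient_span_singleton {π : EisensteinInt} (hπ : π ≠ 0) :
    (Nat.card (EisensteinInt ⧸ Ideal.span {π}) : ℤ) = π.norm := by
  let N : Submodule ℤ EisensteinInt := (Ideal.span {π}).restrictScalars ℤ
  let m : EisensteinInt →ₗ[ℤ] EisensteinInt := DistribSMul.toLinearMap ℤ EisensteinInt π
  have hm : ∀ x, m x = π * x := fun _ ↦ rfl
  have hinj : Function.Injective m := fun x y h ↦ mul_left_cancel₀ hπ h
  have hrange : LinearMap.range m = N := by
    ext x
    simp only [LinearMap.mem_range, hm, N, Submodule.restrictScalars_mem,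
      Ideal.mem_span_singleton', mul_comm π]
  let e : EisensteinInt ≃ₗ[ℤ] N :=
    (LinearEquiv.ofInjective m hinj).trans (LinearEquiv.ofEq _ _ hrange)
  have h := Submodule.natAbs_det_equiv N e
  have he : N.subtype ∘ₗ AddMonoidHom.toIntLinearMap (e : EisensteinInt →+ N) = m := by
    ext x <;> rfl
  have hdet : LinearMap.det m = π.norm := det_toLinearMap_eq_norm π
  rw [he, hdet] at h
  have hc : Nat.card (EisensteinInt ⧸ Ideal.span {π}) = Nat.card (EisensteinInt ⧸ N) := rfl
  rw [hc, ← h, Int.natCast_natAbs, abs_of_nonneg (norm_nonneg π)]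

theorem cong_one_two_iff (a b : ℤ) :
    Cong ((a : EisensteinInt) + (b : EisensteinInt) * omega) 1 2 ↔
      a ≡ 1 [ZMOD 2] ∧ b ≡ 0 [ZMOD 2] := by
  have h2 : (2 : EisensteinInt) = algebraMap ℤ EisensteinInt 2 := rfl
  rw [Cong, h2, algebraMap_dvd_iff, Int.modEq_comm, Int.modEq_comm (a := b), Int.modEq_iff_dvd,
    Int.modEq_iff_dvd]
  simp [omega, re_one, im_one]

namespace IsPrimaryPrime

variable {π : EisensteinInt}

theorem norm_emod_three (hπ : Cong π 2 3) : π.norm % 3 = 1 := by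
  obtain ⟨v, hv⟩ := hπ
  have hre : π.re - 2 = 3 * v.re := by simpa using congrArg QuadraticAlgebra.re hv
  have him : π.im = 3 * v.im := by simpa using congrArg QuadraticAlgebra.im hv
  have hre : π.re = 2 + 3 * v.re := by omega
  rw [norm_eq, hre, him, show (2 + 3 * v.re) ^ 2 - (2 + 3 * v.re) * (3 * v.im) + (3 * v.im) ^ 2 =
    1 + 3 * (1 + 4 * v.re + 3 * v.re ^ 2 - (2 + 3 * v.re) * v.im + 3 * v.im ^ 2) by ring]
  omega

theorem not_dvd_two (hπ : IsPrimaryPrime π) (hne : π ≠ 2) : ¬ π ∣ 2 := by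
  rintro ⟨u, hu⟩
  have hmod := norm_emod_three hπ.2
  have hmul : π.norm * u.norm = 4 := by
    rw [← map_mul, ← hu]
    simp [norm_eq]
  have hπ0 := norm_nonneg π
  have hle : π.norm ≤ 4 := Int.le_of_dvd (by norm_num) ⟨_, hmul.symm⟩
  obtain h | h : π.norm = 1 ∨ π.norm = 4 := by omega
  · exact hπ.1.not_isUnit (isUnit_of_norm_eq_one h)
  · have hun : u.norm = 1 := by rw [h] at hmul; omega
    obtain ⟨v, hv⟩ := hπ.2
    -- From `2 = π u ≡ 2 u (mod 3)` follows `u ≡ 1`.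
    have hu1 : u = 1 := eq_one_of_norm_eq_one hun ⟨u - 1 + v * u, by linear_combination u * hv + hu⟩
    exact hne (by rw [hu, hu1, mul_one])

end IsPrimaryPrime

/-! ### The cubic character and its Jacobi sum -/

section CubicCharacter

variable {F : Type*} [Field F] [Fintype F]

theorem exists_cubic_mulChar (f : EisensteinInt →+* F) {m : ℕ} (hm : 0 < m)
    (hq : Fintype.card F - 1 = 3 * m) :
    ∃ χ : MulChar F EisensteinInt, χ ^ 3 = 1 ∧ χ ≠ 1 ∧ ∀ t, f (χ t) = t ^ m := by
  classical
  obtain ⟨g, hg⟩ := IsCyclic.exists_generator (α := Fˣ)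
  have hcard : Fintype.card Fˣ = 3 * m := by rw [Fintype.card_units, hq]
  have hord : orderOf g = 3 * m := by
    rw [orderOf_eq_card_of_forall_mem_zpowers hg, Nat.card_eq_fintype_card, hcard]
  have hgm1 : (g : F) ^ m ≠ 1 := by
    intro h
    have : orderOf g ∣ m := orderOf_dvd_of_pow_eq_one (by ext; simpa using h)
    have := Nat.le_of_dvd hm this
    omega
  have hgm3 : ((g : F) ^ m) ^ 3 = 1 := by
    rw [← pow_mul, mul_comm, ← hord, ← Units.val_pow_eq_pow_val, pow_orderOf_eq_one, Units.val_one]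
  have hroot : ((g : F) ^ m - f omega) * ((g : F) ^ m - f (omega ^ 2)) = 0 := by
    have hw := congrArg f omega_sq
    simp only [map_add, map_pow, map_one, map_zero] at hw
    have hsq : ((g : F) ^ m) ^ 2 + (g : F) ^ m + 1 = 0 := by
      refine (mul_eq_zero.mp ?_).resolve_left (sub_ne_zero.mpr hgm1)
      linear_combination hgm3
    rw [map_pow]
    linear_combination hsq + (f omega - 1 - (g : F) ^ m) * hw
  -- `χ` will send the generator `g` to whichever of `ω`, `ω²` reduces to `g ^ m`.
  obtain ⟨ζ, hζ3, hζ⟩ : ∃ ζ : EisensteinInt, ζ ^ 3 = 1 ∧ f ζ = (g : F) ^ m := by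
    rcases mul_eq_zero.mp hroot with h | h
    · exact ⟨omega, omega_pow_three, (sub_eq_zero.mp h).symm⟩
    · exact ⟨omega ^ 2, by rw [pow_right_comm, omega_pow_three, one_pow], (sub_eq_zero.mp h).symm⟩
  let z : EisensteinIntˣ := Units.ofPowEqOne ζ 3 hζ3 (by norm_num)
  have hz : z ∈ rootsOfUnity (Fintype.card Fˣ) EisensteinInt := by
    rw [mem_rootsOfUnity, hcard, pow_mul, Units.pow_ofPowEqOne, one_pow]
  have hχg : MulChar.ofRootOfUnity hz hg g = ζ := MulChar.ofRootOfUnity_spec hz hg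
  generalize MulChar.ofRootOfUnity hz hg = χ at hχg
  refine ⟨χ, ?_, ?_, fun t ↦ ?_⟩
  · rw [MulChar.eq_iff hg, MulChar.pow_apply_coe, hχg, hζ3, MulChar.one_apply_coe]
  · rintro rfl
    rw [MulChar.one_apply_coe] at hχg
    rw [← hχg, map_one] at hζ
    exact hgm1 hζ.symm
  · rcases eq_or_ne t 0 with rfl | ht
    · rw [MulChar.map_zero, map_zero, zero_pow hm.ne']
    · obtain ⟨k, hk⟩ := mem_powers_iff_mem_zpowers.mpr (hg (Units.mk0 t ht))
      have hk : (g : F) ^ k = t := by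
        simpa using congrArg Units.val hk
      rw [← hk, map_pow, map_pow, hχg, hζ, pow_right_comm]

/-- Over `ℂ`, `J(χ, χ) J(χ⁻¹, χ⁻¹) = q`, and the second factor is the conjugate of the first. -/
theorem norm_jacobiSum_self {χ : MulChar F EisensteinInt} (h3 : χ ^ 3 = 1) (h1 : χ ≠ 1) :
    (jacobiSum χ χ).norm = Fintype.card F := by
  have hinj := toComplex_injective
  have hχ : χ.ringHomComp toComplex ≠ 1 := (MulChar.ringHomComp_ne_one_iff hinj).mpr h1
  have hχχ : χ.ringHomComp toComplex * χ.ringHomComp toComplex ≠ 1 := by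
    rw [← MulChar.ringHomComp_mul]
    refine (MulChar.ringHomComp_ne_one_iff hinj).mpr fun h ↦ h1 ?_
    rwa [pow_succ, sq, h, one_mul] at h3
  have hchar : ringChar ℂ ≠ ringChar F := by
    rw [ringChar.eq_zero]
    exact (CharP.ringChar_ne_zero_of_finite F).symm
  have h := jacobiSum_mul_jacobiSum_inv hchar hχ hχ hχχ
  have hconj : jacobiSum (χ.ringHomComp toComplex)⁻¹ (χ.ringHomComp toComplex)⁻¹ =
      conj (jacobiSum (χ.ringHomComp toComplex) (χ.ringHomComp toComplex)) := by
    simp only [jacobiSum, map_sum, map_mul, ← MulChar.star_apply']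
    rfl
  rw [hconj, jacobiSum_ringHomComp, Complex.mul_conj, normSq_toComplex] at h
  exact_mod_cast h

theorem jacobiSum_eq_of_isPrimaryPrime {π : EisensteinInt} (hπ : Cong π 2 3)
    (f : EisensteinInt →+* F) (hf : ∀ x, f x = 0 ↔ π ∣ x) (hcard : (Fintype.card F : ℤ) = π.norm)
    {m : ℕ} (hm : 0 < m) (hq : Fintype.card F - 1 = 3 * m) {χ : MulChar F EisensteinInt}
    (h3 : χ ^ 3 = 1) (h1 : χ ≠ 1) (hχ : ∀ t, f (χ t) = t ^ m) : jacobiSum χ χ = π := by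
  have hdvd : π ∣ jacobiSum χ χ := by
    rw [← hf, jacobiSum, map_sum]
    simp only [map_mul, hχ]
    -- The degree `m + m` is below `q - 1 = 3 m`.
    exact FiniteField.sum_pow_mul_one_sub_pow_eq_zero (by omega)
  obtain ⟨u, hu⟩ := hdvd
  have hun : u.norm = 1 := by
    have h := norm_jacobiSum_self h3 h1
    rw [hu, map_mul, ← hcard] at h
    have : (Fintype.card F : ℤ) ≠ 0 := by exact_mod_cast Fintype.card_ne_zero
    exact mul_left_cancel₀ this (h.trans (mul_one _).symm)
  obtain ⟨z, -, hz⟩ := exists_jacobiSum_eq_neg_one_add (by norm_num) h3 h3 ⟨m, hq⟩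
    isPrimitiveRoot_omega
  obtain ⟨v, hv⟩ := hπ
  have hu1 : u = 1 := by
    -- As `(ω - 1)² = -3 ω`, the Jacobi sum is `-1` modulo `3`, as is `π`; hence `u ≡ 1`.
    refine eq_one_of_norm_eq_one hun ⟨z * omega + v * u + u, ?_⟩
    linear_combination hu - hz - z * omega_sq + u * hv
  rw [hu, hu1, mul_one]

theorem exists_pow_three_eq_two_iff {π : EisensteinInt} (hπ : Cong π 2 3)
    (f : EisensteinInt →+* F) (hsurj : Function.Surjective f) (hf : ∀ x, f x = 0 ↔ π ∣ x)
    (hcard : (Fintype.card F : ℤ) = π.norm) (h2 : (2 : F) ≠ 0) :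
    (∃ x : EisensteinInt, Cong (x ^ 3) 2 π) ↔ Cong π 1 2 := by
  have hmod := IsPrimaryPrime.norm_emod_three hπ
  have hlt := Fintype.one_lt_card (α := F)
  obtain ⟨m, hq⟩ : ∃ m, Fintype.card F - 1 = 3 * m := ⟨(Fintype.card F - 1) / 3, by omega⟩
  have hm : 0 < m := by omega
  obtain ⟨χ, h3, h1, hχ⟩ := exists_cubic_mulChar f hm hq
  have hχ3 : ∀ t : F, t ≠ 0 → χ t ^ 3 = 1 := by
    intro t ht
    rw [← MulChar.pow_apply' χ three_ne_zero, h3, MulChar.one_apply ht.isUnit]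
  have hquarter : χ 2⁻¹ * χ 2⁻¹ = χ 2 := by
    -- Writing `1/4` as `2` times a cube turns `χ(1/4)` into `χ(2)`.
    have h8 : (2⁻¹ : F) * 2⁻¹ = 2 * 2⁻¹ ^ 3 := by field_simp
    rw [← map_mul, h8, map_mul, map_pow, hχ3 _ (inv_ne_zero h2), mul_one]
  have hpar : (2 : EisensteinInt) ∣ π - χ 2 := by
    have h := χ.two_dvd_jacobiSum_self_sub h2
    rwa [jacobiSum_eq_of_isPrimaryPrime hπ f hf hcard hm hq h3 h1 hχ, hquarter] at h
  constructor
  · rintro ⟨x, hx⟩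
    have hfx : f x ^ 3 = 2 := by
      have := (hf _).mpr hx
      rw [map_sub, map_pow, map_ofNat] at this
      exact sub_eq_zero.mp this
    have hfx0 : f x ≠ 0 := by
      rintro h
      rw [h, zero_pow three_ne_zero] at hfx
      exact h2 hfx.symm
    rwa [← hfx, map_pow, hχ3 _ hfx0] at hpar
  · intro h
    have hχ2 : χ 2 = 1 := by
      refine eq_one_of_pow_three_eq_one (hχ3 2 h2) ?_
      have := dvd_sub h hpar
      rwa [sub_sub_sub_cancel_left] at this
    obtain ⟨y, hy⟩ := FiniteField.exists_pow_eq_of_pow_eq_one hm hq h2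
      (by rw [← hχ, hχ2, map_one])
    obtain ⟨x, rfl⟩ := hsurj y
    refine ⟨x, (hf _).mp ?_⟩
    rw [map_sub, map_pow, hy, map_ofNat, sub_self]

end CubicCharacter

end EisensteinInt

theorem mainTheorem2 (a b : ℤ) (π : EisensteinInt)
    (hab : π = (a : EisensteinInt) + (b : EisensteinInt) * EisensteinInt.omega)
    (hπ : EisensteinInt.IsPrimaryPrime π) (hne : π ≠ 2) :
    ((∃ x : EisensteinInt, EisensteinInt.Cong (x ^ 3) 2 π) ↔ EisensteinInt.Cong π 1 2) ∧
      (EisensteinInt.Cong π 1 2 ↔ a ≡ 1 [ZMOD 2] ∧ b ≡ 0 [ZMOD 2]) := by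
  refine ⟨?_, by rw [hab]; exact EisensteinInt.cong_one_two_iff a b⟩
  have hspan : Ideal.span {π} ≠ ⊥ := by simpa using hπ.1.ne_zero
  have hprime : (Ideal.span {π}).IsPrime := (Ideal.span_singleton_prime hπ.1.ne_zero).mpr hπ.1
  have hfin : Finite (EisensteinInt ⧸ Ideal.span {π}) :=
    Ideal.finiteQuotientOfFreeOfNeBot _ hspan
  let _ : Fintype (EisensteinInt ⧸ Ideal.span {π}) := Fintype.ofFinite _
  let _ : Field (EisensteinInt ⧸ Ideal.span {π}) :=
    (Finite.isField_of_domain (EisensteinInt ⧸ Ideal.span {π})).toField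
  have hmk : ∀ x, Ideal.Quotient.mk (Ideal.span {π}) x = 0 ↔ π ∣ x := fun x ↦ by
    rw [Ideal.Quotient.eq_zero_iff_mem, Ideal.mem_span_singleton]
  refine EisensteinInt.exists_pow_three_eq_two_iff hπ.2 (Ideal.Quotient.mk (Ideal.span {π}))
    Ideal.Quotient.mk_surjective hmk ?_ fun h ↦ hπ.not_dvd_two hne ?_
  · rw [← Nat.card_eq_fintype_card]
    exact EisensteinInt.card_quotient_span_singleton hπ.1.ne_zero
  · rw [← hmk, map_ofNat]
    exact h
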